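/- A Bratteli diagram $(V,E)$ consists of a vertex set $V=\bigsqcup_{n\ge 0}V_n$ with $V_n$ finite and non-empty, $V_0=\{v_0\}$, and an edge set $E=\bigsqcup_{n\ge1}E_n$ with $E_n$ finite and non-empty, the edges in $E_n$ going from $V_{n-1}$ to $V_n$. Its incidence matrix has as $(i,j)$ entry the number of edges from $i$ to $j$. Let $A,B$ be integer matrices over the same index set, $A\ge 0$, and let $\Omega_A=\{(i,j):A_{i,j}\ne0\}$. Let $E_A$ be the graph whose vertices are the indices and whose edges are $e_{i,j,n}$, $0\le n<A_{i,j}$, from $i$ to $j$ (source $i$, range $j$); let $E_A^*$ be its finite paths (including vertices), $E_A^\infty$ its infinite paths, with the topology inherited from the product of discrete spaces, and $Z(\alpha)=\{\alpha y: y\in E_A^\infty,\ s(y)=r(\alpha)\}$. For $m\in\mathbb Z$ write $mB_{i,j}+n=kA_{i,j}+l$ with $0\le l<A_{i,j}$ and put $\kappa_m(e_{i,j,n})=e_{i,j,l}$, $\varphi(m,e_{i,j,n})=k$; extend to infinite paths by $\kappa_m(ey)=\kappa_m(e)\,\kappa_{\varphi(m,e)}(y)$. The groupoid $\mathcal G_{A,B}$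 consists of the classes $[\alpha,m,\beta;x]$ with $\alpha,\beta\in E_A^*$, $r(\alpha)=r(\beta)$, $m\in\mathbb Z$, $x\in Z(\beta)$, for the equivalence relation generated by $(\alpha,m,\beta;x)\sim(\alpha\kappa_m(\gamma),\varphi(m,\gamma),\beta\gamma;x)$ whenever $\gamma$ is an edge with $x\in Z(\beta\gamma)$. Its unit space is $E_A^\infty$, with $s([\alpha,m,\beta;\beta y])=\beta y$, $r([\alpha,m,\beta;\beta y])=\alpha\kappa_m(y)$, product $[\alpha,m',\beta;\beta\kappa_m(y)]\,[\beta,m,\gamma;\gamma y]=[\alpha,m'+m,\gamma;\gamma y]$, inverse $[\alpha,m,\beta;\beta y]^{-1}=[\beta,-m,\alpha;\alpha\kappa_m(y)]$, and the topology generated by the sets $\{[\alpha,m,\beta;x]:x\in U\}$ with $U\subseteq Z(\beta)$ open. For a groupoid $\mathcal G$ of this kind, or a restriction of it, a bisection is an open set of arrows on which $s$ and $r$ are injective, and $M(\mathcal G)$ denotes the set of Borel probability measures $\mu$ on the unit space $\mathcal G^{(0)}$ with $\mu(s(U))=\mu(r(U))$ for every bisection $U$. **Lemma.** Let $A$ and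 $B$ be the incidence matrices, over a common index set enumerating the vertices of each, of two Bratteli diagrams $(V,E)$ and $(W,F)$, with $|B_{i,j}|<A_{i,j}$ for all $(i,j)\in\Omega_A$. Let $v_0$ be the initial vertex of $(V,E)$, and let $\tilde{\mathcal G}_{A,B}=\{g\in\mathcal G_{A,B}: s(g),r(g)\in Z(v_0)\}$ and $\tilde{\mathcal G}_{A,0}=\{g\in\mathcal G_{A,0}: s(g),r(g)\in Z(v_0)\}$ be the restrictions to $Z(v_0)$ (with the subspace topology), both with unit space $Z(v_0)$. Then $$M(\tilde{\mathcal G}_{A,B})=M(\tilde{\mathcal G}_{A,0}).$$ -/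

import Mathlib

universe u v

/-! ## Topological groupoids, restrictions, bisections, invariant measures -/

/-- A topological groupoid with unit space (identified with) `X`: a small groupoid whose
objects are the points of `X` and whose arrows form a topological space, all structure maps being
continuous. The product `g · h` is defined when `src g = rng h`. -/
structure TopGroupoid (X : Type u) [TopologicalSpace X] where
  Arrow : Type v
  [topArrow : TopologicalSpace Arrow]
  src : Arrow → X
  rng : Arrow → X
  unit : X → Arrow
  inv : Arrow → Arrow
  mul : ∀ g h : Arrow, src g = rng h → Arrow
  src_unit : ∀ x, src (unit x) = x
  rng_unit : ∀ x, rng (unit x) = x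
  src_inv : ∀ g, src (inv g) = rng g
  rng_inv : ∀ g, rng (inv g) = src g
  src_mul : ∀ g h (e : src g = rng h), src (mul g h e) = src h
  rng_mul : ∀ g h (e : src g = rng h), rng (mul g h e) = rng g
  mul_assoc : ∀ g h k (e : src g = rng h) (e' : src h = rng k),
    mul (mul g h e) k ((src_mul g h e).trans e') = mul g (mul h k e') (e.trans (rng_mul h k e').symm)
  mul_unit : ∀ g, mul g (unit (src g)) (rng_unit _).symm = g
  unit_mul : ∀ g, mul (unit (rng g)) g (src_unit _) = g
  inv_mul : ∀ g, mul (inv g) g (src_inv g) = unit (src g)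
  mul_inv : ∀ g, mul g (inv g) (rng_inv g).symm = unit (rng g)
  continuous_src : Continuous src
  continuous_rng : Continuous rng
  continuous_unit : Continuous unit
  continuous_inv : Continuous inv
  continuous_mul : Continuous
    (fun p : {p : Arrow × Arrow // src p.1 = rng p.2} => mul p.1.1 p.1.2 p.2)

namespace TopGroupoid

attribute [instance] TopGroupoid.topArrow

/-- The restriction `G_Y = {g | s(g) ∈ Y, r(g) ∈ Y}`, a groupoid with unit space `Y`. -/
def restrict {X : Type u} [TopologicalSpace X] (G : TopGroupoid.{u, v} X) (Y : Set X) :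
    TopGroupoid.{u, v} Y where
  Arrow := {g : G.Arrow // G.src g ∈ Y ∧ G.rng g ∈ Y}
  src g := ⟨G.src g.1, g.2.1⟩
  rng g := ⟨G.rng g.1, g.2.2⟩
  unit x := ⟨G.unit x.1, by rw [G.src_unit]; exact x.2, by rw [G.rng_unit]; exact x.2⟩
  inv g := ⟨G.inv g.1, by rw [G.src_inv]; exact g.2.2, by rw [G.rng_inv]; exact g.2.1⟩
  mul g h e := ⟨G.mul g.1 h.1 (congrArg Subtype.val e), by rw [G.src_mul]; exact h.2.1,
    by rw [G.rng_mul]; exact g.2.2⟩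
  src_unit x := Subtype.ext (G.src_unit _)
  rng_unit x := Subtype.ext (G.rng_unit _)
  src_inv g := Subtype.ext (G.src_inv _)
  rng_inv g := Subtype.ext (G.rng_inv _)
  src_mul g h e := Subtype.ext (G.src_mul _ _ _)
  rng_mul g h e := Subtype.ext (G.rng_mul _ _ _)
  mul_assoc g h k e e' := Subtype.ext (G.mul_assoc _ _ _ _ _)
  mul_unit g := Subtype.ext (G.mul_unit _)
  unit_mul g := Subtype.ext (G.unit_mul _)
  inv_mul g := Subtype.ext (G.inv_mul _)
  mul_inv g := Subtype.ext (G.mul_inv _)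
  continuous_src := (G.continuous_src.comp continuous_subtype_val).subtype_mk _
  continuous_rng := (G.continuous_rng.comp continuous_subtype_val).subtype_mk _
  continuous_unit := (G.continuous_unit.comp continuous_subtype_val).subtype_mk _
  continuous_inv := (G.continuous_inv.comp continuous_subtype_val).subtype_mk _
  continuous_mul := by
    refine Continuous.subtype_mk ?_ _
    exact G.continuous_mul.comp (Continuous.subtype_mk
      ((continuous_subtype_val.comp (continuous_fst.comp continuous_subtype_val)).prodMk
        (continuous_subtype_val.comp (continuous_snd.comp continuous_subtype_val)))
      (fun p => congrArg Subtype.val p.2))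

/-- A bisection: an open set of arrows on which `s` and `r` are injective. -/
def IsBisection {X : Type u} [TopologicalSpace X] (G : TopGroupoid.{u, v} X)
    (U : Set G.Arrow) : Prop :=
  IsOpen U ∧ Set.InjOn G.src U ∧ Set.InjOn G.rng U

/-- `M(G)`: the Borel probability measures `μ` on the unit space with `μ(s(U)) = μ(r(U))` for
every bisection `U`. -/
def invariantProbabilityMeasures {X : Type u} [TopologicalSpace X] [MeasurableSpace X]
    [BorelSpace X] (G : TopGroupoid.{u, v} X) : Set (MeasureTheory.ProbabilityMeasure X) :=
  {μ | ∀ U : Set G.Arrow, G.IsBisection U →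
    (μ : MeasureTheory.Measure X) (G.src '' U) = (μ : MeasureTheory.Measure X) (G.rng '' U)}

end TopGroupoid

/-! ## The Katsura-Exel-Pardo groupoid of a pair of integer matrices -/

namespace KatsuraGroupoid

variable {ι : Type u}

/-- The edges `e_{i,j,n}`, `0 ≤ n < A i j`, of the graph of `A`; `src = i`, `tgt = j`, `idx = n`. -/
@[ext] structure Edge (A : Matrix ι ι ℤ) where
  src : ι
  tgt : ι
  idx : ℤ
  idx_nonneg : 0 ≤ idx
  idx_lt : idx < A src tgt

instance (A : Matrix ι ι ℤ) : TopologicalSpace (Edge A) := ⊥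

instance (A : Matrix ι ι ℤ) : DiscreteTopology (Edge A) := ⟨rfl⟩

variable {A : Matrix ι ι ℤ}

lemma Edge.pos (e : Edge A) : 0 < A e.src e.tgt := e.idx_nonneg.trans_lt e.idx_lt

/-- `κ_m(e_{i,j,n}) = e_{i,j,l}`, where `m B_{ij} + n = k A_{ij} + l` and `0 ≤ l < A_{ij}`. -/
def Edge.act (B : Matrix ι ι ℤ) (m : ℤ) (e : Edge A) : Edge A where
  src := e.src
  tgt := e.tgt
  idx := (m * B e.src e.tgt + e.idx) % A e.src e.tgt
  idx_nonneg := Int.emod_nonneg _ e.pos.ne'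
  idx_lt := Int.emod_lt_of_pos _ e.pos

/-- `φ(m, e_{i,j,n}) = k`, where `m B_{ij} + n = k A_{ij} + l` and `0 ≤ l < A_{ij}`. -/
def Edge.cocycle (B : Matrix ι ι ℤ) (m : ℤ) (e : Edge A) : ℤ :=
  (m * B e.src e.tgt + e.idx) / A e.src e.tgt

lemma Edge.act_zero (B : Matrix ι ι ℤ) (e : Edge A) : e.act B 0 = e := by
  ext <;> simp [Edge.act, Int.emod_eq_of_lt e.idx_nonneg e.idx_lt]

lemma Edge.cocycle_zero (B : Matrix ι ι ℤ) (e : Edge A) : e.cocycle B 0 = 0 := by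
  simp [Edge.cocycle, Int.ediv_eq_zero_of_lt e.idx_nonneg e.idx_lt]

lemma Edge.act_add (B : Matrix ι ι ℤ) (m n : ℤ) (e : Edge A) :
    e.act B (m + n) = (e.act B n).act B m := by
  ext
  · rfl
  · rfl
  · simp only [Edge.act, Int.add_emod_emod]
    ring_nf

lemma Edge.cocycle_add (B : Matrix ι ι ℤ) (m n : ℤ) (e : Edge A) :
    e.cocycle B (m + n) = (e.act B n).cocycle B m + e.cocycle B n := by
  simp only [Edge.cocycle, Edge.act]
  rw [← Int.add_mul_ediv_right _ _ e.pos.ne']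
  congr 1
  have := Int.emod_add_ediv_mul (n * B e.src e.tgt + e.idx) (A e.src e.tgt)
  linarith

/-- `l` is the list of edges of a finite path starting at `v`. -/
def IsPathFrom : ι → List (Edge A) → Prop
  | _, [] => True
  | v, e :: l => e.src = v ∧ IsPathFrom e.tgt l

/-- The end vertex of the finite path starting at `v` with list of edges `l`. -/
def endVertex : ι → List (Edge A) → ι
  | v, [] => v
  | _, e :: l => endVertex e.tgt l

lemma isPathFrom_snoc (v : ι) (l : List (Edge A)) (e : Edge A) (hl : IsPathFrom v l)
    (he : endVertex v l = e.src) : IsPathFrom v (l ++ [e]) := by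
  induction l generalizing v with
  | nil => exact ⟨he.symm, trivial⟩
  | cons a l ih => exact ⟨hl.1, ih _ hl.2 he⟩

lemma endVertex_snoc (v : ι) (l : List (Edge A)) (e : Edge A) :
    endVertex v (l ++ [e]) = e.tgt := by
  induction l generalizing v with
  | nil => rfl
  | cons a l ih => exact ih _

/-- Finite paths, including the paths of length zero (the vertices). -/
@[ext] structure FinPath (A : Matrix ι ι ℤ) where
  source : ι
  edges : List (Edge A)
  isPath : IsPathFrom source edges

namespace FinPath

def range (α : FinPath A) : ι := endVertex α.source α.edges

def length (α : FinPath A) : ℕ := α.edges.length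

/-- The path `α e`. -/
def snoc (α : FinPath A) (e : Edge A) (h : α.range = e.src) : FinPath A :=
  ⟨α.source, α.edges ++ [e], isPathFrom_snoc _ _ _ α.isPath h⟩

/-- The path of length zero at `v`. -/
def vertex (A : Matrix ι ι ℤ) (v : ι) : FinPath A := ⟨v, [], trivial⟩

lemma range_snoc (α : FinPath A) (e : Edge A) (h : α.range = e.src) :
    (α.snoc e h).range = e.tgt := endVertex_snoc _ _ _

lemma length_snoc (α : FinPath A) (e : Edge A) (h : α.range = e.src) :
    (α.snoc e h).length = α.length + 1 := by
  simp [snoc, length]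

end FinPath

/-- The sequence obtained by putting the list `l` in front of the sequence `y`. -/
def seqAppend : List (Edge A) → (ℕ → Edge A) → ℕ → Edge A
  | [], y, n => y n
  | e :: _, _, 0 => e
  | _ :: l, y, n + 1 => seqAppend l y n

lemma seqAppend_snoc (l : List (Edge A)) (e : Edge A) (y : ℕ → Edge A) (z : ℕ → Edge A)
    (h0 : z 0 = e) (h1 : ∀ n, z (n + 1) = y n) :
    seqAppend (l ++ [e]) y = seqAppend l z := by
  induction l with
  | nil =>
    funext n
    cases n with
    | zero => exact h0.symm
    | succ n => exact (h1 n).symm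
  | cons a l ih =>
    funext n
    cases n with
    | zero => rfl
    | succ n => exact congrFun ih n

lemma seqAppend_inj (l l' : List (Edge A)) (y y' : ℕ → Edge A) (h : l.length = l'.length)
    (e : seqAppend l y = seqAppend l' y') : l = l' ∧ y = y' := by
  induction l generalizing l' with
  | nil =>
    cases l' with
    | nil => exact ⟨rfl, e⟩
    | cons a l' => simp at h
  | cons a l ih =>
    cases l' with
    | nil => simp at h
    | cons a' l' =>
      have h0 : a = a' := congrFun e 0
      obtain ⟨h1, h2⟩ := ih l' (by simpa using h) (funext fun n => congrFun e (n + 1))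
      exact ⟨by rw [h0, h1], h2⟩

lemma seqAppend_isPath (v : ι) (l : List (Edge A)) (y : ℕ → Edge A)
    (hl : IsPathFrom v l) (hy : ∀ n, (y n).tgt = (y (n + 1)).src)
    (h : endVertex v l = (y 0).src) :
    (seqAppend l y 0).src = v ∧ ∀ n, (seqAppend l y n).tgt = (seqAppend l y (n + 1)).src := by
  induction l generalizing v with
  | nil => exact ⟨h.symm, hy⟩
  | cons a l ih =>
    obtain ⟨h1, h2⟩ := ih _ hl.2 h
    refine ⟨hl.1, fun n => ?_⟩
    cases n with
    | zero => exact h1.symm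
    | succ n => exact h2 n

/-- Infinite paths. -/
@[ext] structure InfPath (A : Matrix ι ι ℤ) where
  edge : ℕ → Edge A
  isPath : ∀ n, (edge n).tgt = (edge (n + 1)).src

/-- The infinite path space is a subspace of the product of countably many copies of the discrete
set of edges. -/
instance (A : Matrix ι ι ℤ) : TopologicalSpace (InfPath A) :=
  TopologicalSpace.induced InfPath.edge inferInstance

instance (A : Matrix ι ι ℤ) : MeasurableSpace (InfPath A) := borel _

instance (A : Matrix ι ι ℤ) : BorelSpace (InfPath A) := ⟨rfl⟩

namespace InfPath

def source (x : InfPath A) : ι := (x.edge 0).src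

def tail (x : InfPath A) : InfPath A := ⟨fun n => x.edge (n + 1), fun n => x.isPath (n + 1)⟩

/-- `φ(m, y_{|n})`, by the recursion `φ(m, αe) = φ(φ(m, α), e)`. -/
def cocycle (B : Matrix ι ι ℤ) (m : ℤ) (y : InfPath A) : ℕ → ℤ
  | 0 => m
  | n + 1 => (y.edge n).cocycle B (cocycle B m y n)

/-- The action on infinite paths: the `n`-th edge `e` of `κ_m(y)` is `κ_k(y_n)`, where `k` is the
value of the cocycle on `m` and the initial segment of `y` before `y_n`. -/
def act (B : Matrix ι ι ℤ) (m : ℤ) (y : InfPath A) : InfPath A :=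
  ⟨fun n => (y.edge n).act B (cocycle B m y n), fun n => y.isPath n⟩

lemma source_act (B : Matrix ι ι ℤ) (m : ℤ) (y : InfPath A) : (y.act B m).source = y.source := rfl

lemma cocycle_zero (B : Matrix ι ι ℤ) (y : InfPath A) (n : ℕ) : cocycle B 0 y n = 0 := by
  induction n with
  | zero => rfl
  | succ n ih => simp [cocycle, ih, Edge.cocycle_zero]

lemma act_zero (B : Matrix ι ι ℤ) (y : InfPath A) : y.act B 0 = y := by
  apply InfPath.ext
  funext n
  simp [act, cocycle_zero, Edge.act_zero]

lemma cocycle_add (B : Matrix ι ι ℤ) (m k : ℤ) (y : InfPath A) (n : ℕ) :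
    cocycle B (m + k) y n = cocycle B m (y.act B k) n + cocycle B k y n := by
  induction n with
  | zero => rfl
  | succ n ih => simp only [cocycle, ih, Edge.cocycle_add]; rfl

lemma act_add (B : Matrix ι ι ℤ) (m k : ℤ) (y : InfPath A) :
    y.act B (m + k) = (y.act B k).act B m := by
  apply InfPath.ext
  funext n
  simp only [act, cocycle_add, Edge.act_add]

lemma cocycle_succ (B : Matrix ι ι ℤ) (m : ℤ) (y : InfPath A) (n : ℕ) :
    cocycle B m y (n + 1) = cocycle B ((y.edge 0).cocycle B m) y.tail n := by
  induction n with
  | zero => rfl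
  | succ n ih => rw [cocycle, ih]; rfl

lemma tail_act (B : Matrix ι ι ℤ) (m : ℤ) (y : InfPath A) :
    (y.act B m).tail = y.tail.act B ((y.edge 0).cocycle B m) := by
  apply InfPath.ext
  funext n
  simp only [tail, act, cocycle_succ]

end InfPath

namespace FinPath

/-- The infinite path `α y`. -/
def concat (α : FinPath A) (y : InfPath A) (h : α.range = y.source) : InfPath A :=
  ⟨seqAppend α.edges y.edge, (seqAppend_isPath _ _ _ α.isPath y.isPath h).2⟩

/-- `Z(α)`. -/
def cylinder (α : FinPath A) : Set (InfPath A) :=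
  {x | ∃ (y : InfPath A) (h : α.range = y.source), x = α.concat y h}

lemma source_concat (α : FinPath A) (y : InfPath A) (h : α.range = y.source) :
    (α.concat y h).source = α.source := (seqAppend_isPath _ _ _ α.isPath y.isPath h).1

lemma concat_inj (α α' : FinPath A) (y y' : InfPath A) (h : α.range = y.source)
    (h' : α'.range = y'.source) (hl : α.length = α'.length)
    (e : α.concat y h = α'.concat y' h') : α = α' ∧ y = y' := by
  have h1 := seqAppend_inj _ _ _ _ hl (congrArg InfPath.edge e)
  refine ⟨FinPath.ext ?_ h1.1, InfPath.ext h1.2⟩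
  rw [← source_concat α y h, ← source_concat α' y' h', e]

end FinPath

/-- A quadruple `(α, m, β; x)` with `r(α) = r(β)` and `x = β y ∈ Z(β)`; since `x` and `y`
determine each other, it is the tail `y` that is recorded. -/
@[ext] structure Quad (A : Matrix ι ι ℤ) where
  left : FinPath A
  deg : ℤ
  right : FinPath A
  tail : InfPath A
  left_range : left.range = tail.source
  right_range : right.range = tail.source

namespace Quad

/-- `x = β y`. -/
def src (q : Quad A) : InfPath A := q.right.concat q.tail q.right_range

/-- `α κ_m(y)`. -/
def rng (B : Matrix ι ι ℤ) (q : Quad A) : InfPath A :=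
  q.left.concat (q.tail.act B q.deg) q.left_range

/-- For `x = β γ y'` with `γ` an edge, the passage from `(α, m, β; x)` to
`(α κ_m(γ), φ(m, γ), β γ; x)`. -/
def refine (B : Matrix ι ι ℤ) (q : Quad A) : Quad A where
  left := q.left.snoc ((q.tail.edge 0).act B q.deg) q.left_range
  deg := (q.tail.edge 0).cocycle B q.deg
  right := q.right.snoc (q.tail.edge 0) q.right_range
  tail := q.tail.tail
  left_range := (FinPath.range_snoc _ _ _).trans (q.tail.isPath 0)
  right_range := (FinPath.range_snoc _ _ _).trans (q.tail.isPath 0)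

lemma src_refine (B : Matrix ι ι ℤ) (q : Quad A) : (q.refine B).src = q.src := by
  apply InfPath.ext
  exact seqAppend_snoc _ _ _ _ rfl (fun n => rfl)

lemma rng_refine (B : Matrix ι ι ℤ) (q : Quad A) : (q.refine B).rng B = q.rng B := by
  apply InfPath.ext
  refine seqAppend_snoc _ _ _ _ rfl (fun n => ?_)
  exact congrArg (fun z : InfPath A => z.edge n) (InfPath.tail_act B q.deg q.tail)

end Quad

/-- The arrows of `G_{A,B}`: quadruples modulo the equivalence relation generated by
`(α, m, β; x) ∼ (α κ_m(γ), φ(m, γ), β γ; x)`. -/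
def Arrow (A B : Matrix ι ι ℤ) : Type u :=
  Quot (fun q q' : Quad A => q' = q.refine B)

variable {B : Matrix ι ι ℤ}

namespace Arrow

/-- The class `[α, m, β; x]`. -/
def mk (B : Matrix ι ι ℤ) (q : Quad A) : Arrow A B := Quot.mk _ q

def src (g : Arrow A B) : InfPath A :=
  Quot.lift Quad.src (fun q q' h => by rw [h, Quad.src_refine]) g

def rng (g : Arrow A B) : InfPath A :=
  Quot.lift (Quad.rng B) (fun q q' h => by rw [h, Quad.rng_refine]) g

/-- The set `Z(α, m, β; U) = {[α, m, β; x] | x ∈ U}`. -/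
def basicSet (B : Matrix ι ι ℤ) (α : FinPath A) (m : ℤ) (β : FinPath A) (U : Set (InfPath A)) :
    Set (Arrow A B) :=
  {g | ∃ q : Quad A, q.left = α ∧ q.deg = m ∧ q.right = β ∧ q.src ∈ U ∧ g = mk B q}

/-- The topology of `G_{A,B}`, generated by the sets `Z(α, m, β; U)` with `U ⊆ Z(β)` open. (If `A`
is row-finite, each such `U` is a union of compact open sets, so that the compact open `U` give the
same topology.) -/
instance : TopologicalSpace (Arrow A B) :=
  TopologicalSpace.generateFrom
    {S | ∃ (α : FinPath A) (m : ℤ) (β : FinPath A) (U : Set (InfPath A)),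
      α.range = β.range ∧ IsOpen U ∧ U ⊆ β.cylinder ∧ S = basicSet B α m β U}

lemma mk_refine (q : Quad A) : mk B (q.refine B) = mk B q := (Quot.sound (r := fun q q' : Quad A => q' = q.refine B) rfl).symm

lemma mk_iterate (q : Quad A) (n : ℕ) : mk B ((Quad.refine B)^[n] q) = mk B q := by
  induction n with
  | zero => rfl
  | succ n ih => rw [Function.iterate_succ_apply', mk_refine, ih]

lemma mk_eq_iff (q q' : Quad A) :
    mk B q = mk B q' ↔ ∃ n n', (Quad.refine B)^[n] q = (Quad.refine B)^[n'] q' := by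
  constructor
  · intro h
    have h' := Quot.eqvGen_exact h
    clear h
    induction h' with
    | rel x y h => exact ⟨1, 0, h.symm⟩
    | refl x => exact ⟨0, 0, rfl⟩
    | symm x y _ ih =>
      obtain ⟨n, n', e⟩ := ih
      exact ⟨n', n, e.symm⟩
    | trans x y z _ _ ih1 ih2 =>
      obtain ⟨a, b, e1⟩ := ih1
      obtain ⟨c, d, e2⟩ := ih2
      refine ⟨c + a, b + d, ?_⟩
      rw [Function.iterate_add_apply, e1, ← Function.iterate_add_apply, Nat.add_comm c b,
        Function.iterate_add_apply, e2, ← Function.iterate_add_apply]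
  · rintro ⟨n, n', e⟩
    rw [← mk_iterate q n, e, mk_iterate]

end Arrow

namespace Quad

lemma src_iterate (q : Quad A) (n : ℕ) : ((refine B)^[n] q).src = q.src := by
  induction n with
  | zero => rfl
  | succ n ih => rw [Function.iterate_succ_apply', src_refine, ih]

lemma rng_iterate (q : Quad A) (n : ℕ) : ((refine B)^[n] q).rng B = q.rng B := by
  induction n with
  | zero => rfl
  | succ n ih => rw [Function.iterate_succ_apply', rng_refine, ih]

lemma length_left_iterate (q : Quad A) (n : ℕ) :
    ((refine B)^[n] q).left.length = q.left.length + n := by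
  induction n with
  | zero => rfl
  | succ n ih =>
    rw [Function.iterate_succ_apply', ← Nat.add_assoc, ← ih]
    simp [refine, FinPath.snoc, FinPath.length]

lemma length_right_iterate (q : Quad A) (n : ℕ) :
    ((refine B)^[n] q).right.length = q.right.length + n := by
  induction n with
  | zero => rfl
  | succ n ih =>
    rw [Function.iterate_succ_apply', ← Nat.add_assoc, ← ih]
    simp [refine, FinPath.snoc, FinPath.length]

/-- `q = (α, m', β; β κ_m(y))` and `p = (β, m, γ; γ y)`. -/
def Composable (B : Matrix ι ι ℤ) (q p : Quad A) : Prop :=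
  q.right = p.left ∧ q.tail = p.tail.act B p.deg

/-- For composable quadruples `(α, m', β; β κ_m(y))` and `(β, m, γ; γ y)`, the quadruple
`(α, m' + m, γ; γ y)`. -/
def comp (q p : Quad A) (h : Composable B q p) : Quad A where
  left := q.left
  deg := q.deg + p.deg
  right := p.right
  tail := p.tail
  left_range := by rw [q.left_range, h.2]; rfl
  right_range := p.right_range

lemma composable_of (q p : Quad A) (h : q.src = p.rng B)
    (hl : q.right.length = p.left.length) : Composable B q p :=
  FinPath.concat_inj _ _ _ _ _ _ hl h

lemma Composable.src_eq {q p : Quad A} (h : Composable B q p) : q.src = p.rng B := by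
  apply InfPath.ext
  simp only [src, rng, FinPath.concat, h.1, h.2]

lemma Composable.refine {q p : Quad A} (h : Composable B q p) :
    Composable B (q.refine B) (p.refine B) := by
  apply composable_of
  · rw [src_refine, rng_refine, h.src_eq]
  · simp [Quad.refine, FinPath.snoc, FinPath.length, h.1]

lemma comp_refine {q p : Quad A} (h : Composable B q p) :
    comp (q.refine B) (p.refine B) h.refine = (comp q p h).refine B := by
  have e0 : q.tail.edge 0 = (p.tail.edge 0).act B p.deg := by rw [h.2]; rfl
  apply Quad.ext
  · apply FinPath.ext
    · rfl
    · simp only [comp, Quad.refine, FinPath.snoc, e0, Edge.act_add]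
  · simp only [comp, Quad.refine, e0, Edge.cocycle_add]
  · rfl
  · rfl

lemma comp_iterate {q p : Quad A} (h : Composable B q p) (n : ℕ) :
    ∃ h' : Composable B ((Quad.refine B)^[n] q) ((Quad.refine B)^[n] p),
      comp _ _ h' = (Quad.refine B)^[n] (comp q p h) := by
  induction n with
  | zero => exact ⟨h, rfl⟩
  | succ n ih =>
    obtain ⟨h', e⟩ := ih
    simp only [Function.iterate_succ_apply']
    exact ⟨h'.refine, (comp_refine h').trans (congrArg _ e)⟩

lemma src_comp {q p : Quad A} (h : Composable B q p) : (comp q p h).src = p.src := rfl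

lemma rng_comp {q p : Quad A} (h : Composable B q p) : (comp q p h).rng B = q.rng B := by
  apply InfPath.ext
  simp only [rng, FinPath.concat, comp, h.2, InfPath.act_add]

/-- For `x = β y`, the passage from `(α, m, β; x)` to `(β, -m, α; α κ_m(y))`. -/
def inv (B : Matrix ι ι ℤ) (q : Quad A) : Quad A where
  left := q.right
  deg := -q.deg
  right := q.left
  tail := q.tail.act B q.deg
  left_range := q.right_range
  right_range := q.left_range

lemma src_inv (q : Quad A) : (q.inv B).src = q.rng B := rfl

lemma rng_inv (q : Quad A) : (q.inv B).rng B = q.src := by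
  apply InfPath.ext
  simp only [rng, src, FinPath.concat, inv, ← InfPath.act_add, neg_add_cancel, InfPath.act_zero]

lemma inv_refine (q : Quad A) : (q.refine B).inv B = (q.inv B).refine B := by
  have h1 := Edge.act_add B (-q.deg) q.deg (q.tail.edge 0)
  have h2 := Edge.cocycle_add B (-q.deg) q.deg (q.tail.edge 0)
  rw [neg_add_cancel, Edge.act_zero] at h1
  rw [neg_add_cancel, Edge.cocycle_zero] at h2
  apply Quad.ext
  · apply FinPath.ext
    · rfl
    · exact congrArg (fun e => q.right.edges ++ [e]) h1
  · change -((q.tail.edge 0).cocycle B q.deg) =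
      ((q.tail.edge 0).act B q.deg).cocycle B (-q.deg)
    linarith
  · rfl
  · exact (InfPath.tail_act B q.deg q.tail).symm

lemma inv_iterate (q : Quad A) (n : ℕ) :
    ((refine B)^[n] q).inv B = (refine B)^[n] (q.inv B) := by
  induction n with
  | zero => rfl
  | succ n ih => rw [Function.iterate_succ_apply', inv_refine, ih, Function.iterate_succ_apply']

/-- The quadruple `(β, 0, β; β y)`. -/
def idem (β : FinPath A) (y : InfPath A) (h : β.range = y.source) : Quad A := ⟨β, 0, β, y, h, h⟩

lemma rng_idem (β : FinPath A) (y : InfPath A) (h : β.range = y.source) :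
    (idem β y h).rng B = (idem β y h).src := by
  apply InfPath.ext
  simp only [rng, src, FinPath.concat, idem, InfPath.act_zero]

lemma refine_idem (β : FinPath A) (y : InfPath A) (h : β.range = y.source) :
    ∃ h', (idem β y h).refine B = idem (β.snoc (y.edge 0) h) y.tail h' := by
  refine ⟨(FinPath.range_snoc _ _ _).trans (y.isPath 0), ?_⟩
  apply Quad.ext
  · apply FinPath.ext
    · rfl
    · simp only [idem, Quad.refine, FinPath.snoc, Edge.act_zero]
  · simp only [idem, Quad.refine, Edge.cocycle_zero]
  · rfl
  · rfl

lemma iterate_idem (β : FinPath A) (y : InfPath A) (h : β.range = y.source) (n : ℕ) :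
    ∃ β' y' h', (Quad.refine B)^[n] (idem β y h) = idem β' y' h' := by
  induction n with
  | zero => exact ⟨β, y, h, rfl⟩
  | succ n ih =>
    obtain ⟨β', y', h', e⟩ := ih
    obtain ⟨h'', e'⟩ := refine_idem (B := B) β' y' h'
    exact ⟨_, _, h'', by rw [Function.iterate_succ_apply', e, e']⟩

end Quad

namespace Arrow

/-- The unit `[v, 0, v; x]` at `x`, where `v` is the source of `x`. -/
def unit (B : Matrix ι ι ℤ) (x : InfPath A) : Arrow A B :=
  mk B (Quad.idem (FinPath.vertex A x.source) x rfl)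

/-- `[α, m, β; β y]⁻¹ = [β, -m, α; α κ_m(y)]`. -/
def inv (g : Arrow A B) : Arrow A B :=
  Quot.lift (fun q => mk B (q.inv B))
    (fun q q' h => by rw [h, Quad.inv_refine, mk_refine]) g

/-- `k = g · h`, that is, `g = [α, m', β; β κ_m(y)]`, `h = [β, m, γ; γ y]` and
`k = [α, m' + m, γ; γ y]` for some representatives. -/
def IsProduct (g h k : Arrow A B) : Prop :=
  ∃ (q p : Quad A) (c : Quad.Composable B q p), g = mk B q ∧ h = mk B p ∧ k = mk B (q.comp p c)

lemma IsProduct.unique {g h k k' : Arrow A B} (H : IsProduct g h k) (H' : IsProduct g h k') :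
    k = k' := by
  obtain ⟨q, p, c, hg, hh, rfl⟩ := H
  obtain ⟨q', p', c', hg', hh', rfl⟩ := H'
  obtain ⟨a, b, e1⟩ := (mk_eq_iff q q').1 (hg.symm.trans hg')
  obtain ⟨s, t, e2⟩ := (mk_eq_iff p p').1 (hh.symm.trans hh')
  have f1 : (Quad.refine B)^[a + s] q = (Quad.refine B)^[b + s] q' := by
    rw [Nat.add_comm a, Nat.add_comm b, Function.iterate_add_apply, e1,
      ← Function.iterate_add_apply]
  have f2 : (Quad.refine B)^[a + s] p = (Quad.refine B)^[a + t] p' := by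
    rw [Function.iterate_add_apply, e2, ← Function.iterate_add_apply]
  have l1 := congrArg (fun z : Quad A => z.right.length) f1
  have l2 := congrArg (fun z : Quad A => z.left.length) f2
  simp only [Quad.length_right_iterate, Quad.length_left_iterate] at l1 l2
  rw [c.1] at l1
  rw [c'.1] at l1
  have e3 : a + t = b + s := by omega
  rw [e3] at f2
  obtain ⟨d, ed⟩ := Quad.comp_iterate c (a + s)
  obtain ⟨d', ed'⟩ := Quad.comp_iterate c' (b + s)
  have : Quad.comp _ _ d = Quad.comp _ _ d' := by congr 1
  rw [ed, ed'] at this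
  exact (mk_eq_iff _ _).2 ⟨_, _, this⟩

lemma exists_mk (g : Arrow A B) : ∃ q, g = mk B q := by
  obtain ⟨q, rfl⟩ := Quot.exists_rep g
  exact ⟨q, rfl⟩

lemma IsProduct.exists {g h : Arrow A B} (e : src g = rng h) : ∃ k, IsProduct g h k := by
  obtain ⟨q, rfl⟩ := exists_mk g
  obtain ⟨p, rfl⟩ := exists_mk h
  have c : Quad.Composable B ((Quad.refine B)^[p.left.length] q)
      ((Quad.refine B)^[q.right.length] p) := by
    apply Quad.composable_of
    · rw [Quad.src_iterate, Quad.rng_iterate]; exact e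
    · rw [Quad.length_right_iterate, Quad.length_left_iterate, Nat.add_comm]
  exact ⟨_, _, _, c, (mk_iterate _ _).symm, (mk_iterate _ _).symm, rfl⟩

/-- The product `g · h`. -/
noncomputable def mul (g h : Arrow A B) (e : src g = rng h) : Arrow A B :=
  Classical.choose (IsProduct.exists e)

lemma mul_spec (g h : Arrow A B) (e : src g = rng h) : IsProduct g h (mul g h e) :=
  Classical.choose_spec (IsProduct.exists e)

lemma mul_mk {q p : Quad A} (c : Quad.Composable B q p) (e : src (mk B q) = rng (mk B p)) :
    mul (mk B q) (mk B p) e = mk B (q.comp p c) :=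
  (mul_spec _ _ e).unique ⟨q, p, c, rfl, rfl, rfl⟩

lemma mul_eq {g h k : Arrow A B} (H : IsProduct g h k) (e : src g = rng h) : mul g h e = k :=
  (mul_spec _ _ e).unique H

lemma src_mul (g h : Arrow A B) (e : src g = rng h) : src (mul g h e) = src h := by
  obtain ⟨q, p, c, -, rfl, hk⟩ := mul_spec g h e
  rw [hk]; rfl

lemma rng_mul (g h : Arrow A B) (e : src g = rng h) : rng (mul g h e) = rng g := by
  obtain ⟨q, p, c, rfl, -, hk⟩ := mul_spec g h e
  rw [hk]; exact Quad.rng_comp c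

lemma mul_assoc (g h k : Arrow A B) (e : src g = rng h) (e' : src h = rng k) :
    mul (mul g h e) k ((src_mul g h e).trans e') =
      mul g (mul h k e') (e.trans (rng_mul h k e').symm) := by
  obtain ⟨q, rfl⟩ := exists_mk g
  obtain ⟨p, rfl⟩ := exists_mk h
  obtain ⟨r, rfl⟩ := exists_mk k
  have key : ∃ q' p' r', ∃ (c : Quad.Composable B q' p') (d : Quad.Composable B p' r'),
      mk B q = mk B q' ∧ mk B p = mk B p' ∧ mk B r = mk B r' := by
    refine ⟨(Quad.refine B)^[p.left.length + r.left.length] q,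
      (Quad.refine B)^[q.right.length + r.left.length] p,
      (Quad.refine B)^[p.right.length + q.right.length] r, ?_, ?_,
      (mk_iterate _ _).symm, (mk_iterate _ _).symm, (mk_iterate _ _).symm⟩
    · apply Quad.composable_of
      · rw [Quad.src_iterate, Quad.rng_iterate]; exact e
      · rw [Quad.length_right_iterate, Quad.length_left_iterate]; omega
    · apply Quad.composable_of
      · rw [Quad.src_iterate, Quad.rng_iterate]; exact e'
      · rw [Quad.length_right_iterate, Quad.length_left_iterate]; omega
  obtain ⟨q', p', r', c, d, h1, h2, h3⟩ := key
  have c' : Quad.Composable B (q'.comp p' c) r' := d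
  have d' : Quad.Composable B q' (p'.comp r' d) := by
    refine ⟨c.1, ?_⟩
    rw [c.2, d.2, ← InfPath.act_add]; rfl
  have a1 : mul (mk B q) (mk B p) e = mk B (q'.comp p' c) := mul_eq ⟨q', p', c, h1, h2, rfl⟩ e
  have a2 : mul (mk B p) (mk B r) e' = mk B (p'.comp r' d) := mul_eq ⟨p', r', d, h2, h3, rfl⟩ e'
  rw [mul_eq ⟨_, _, c', a1, h3, rfl⟩, mul_eq ⟨_, _, d', h1, a2, rfl⟩]
  congr 1
  apply Quad.ext
  · rfl
  · exact add_assoc _ _ _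
  · rfl
  · rfl

lemma unit_src (q : Quad A) : unit B q.src = mk B (Quad.idem q.right q.tail q.right_range) := by
  rw [unit, mk_eq_iff]
  refine ⟨q.right.length, 0, ?_⟩
  obtain ⟨β', y', h', e⟩ := Quad.iterate_idem (B := B) (FinPath.vertex A q.src.source) q.src rfl
    q.right.length
  have hl : β'.length = q.right.length := by
    have := congrArg (fun z : Quad A => z.right.length) e
    simp only [Quad.length_right_iterate] at this
    rw [← show _ = β'.length from this]
    exact Nat.zero_add _
  have hs : β'.concat y' h' = q.right.concat q.tail q.right_range := by
    have := congrArg Quad.src e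
    rw [Quad.src_iterate] at this
    exact this.symm
  obtain ⟨rfl, rfl⟩ := FinPath.concat_inj _ _ _ _ _ _ hl hs
  exact e

lemma src_inv (g : Arrow A B) : src (inv g) = rng g := by
  obtain ⟨q, rfl⟩ := exists_mk g
  rfl

lemma rng_inv (g : Arrow A B) : rng (inv g) = src g := by
  obtain ⟨q, rfl⟩ := exists_mk g
  exact Quad.rng_inv q

lemma src_unit (x : InfPath A) : src (unit B x) = x := rfl

lemma rng_unit (x : InfPath A) : rng (unit B x) = x := Quad.rng_idem _ _ _

lemma mul_unit (g : Arrow A B) : mul g (unit B (src g)) (rng_unit _).symm = g := by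
  obtain ⟨q, rfl⟩ := exists_mk g
  refine mul_eq ⟨q, Quad.idem q.right q.tail q.right_range,
    ⟨rfl, (InfPath.act_zero _ _).symm⟩, rfl, unit_src q, ?_⟩ _
  congr 1
  apply Quad.ext
  · rfl
  · exact (add_zero _).symm
  · rfl
  · rfl

lemma unit_rng (q : Quad A) : unit B (q.rng B) =
    mk B (Quad.idem q.left (q.tail.act B q.deg) q.left_range) :=
  unit_src (q.inv B)

lemma unit_mul (g : Arrow A B) : mul (unit B (rng g)) g (src_unit _) = g := by
  obtain ⟨q, rfl⟩ := exists_mk g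
  refine mul_eq ⟨Quad.idem q.left (q.tail.act B q.deg) q.left_range, q,
    ⟨rfl, rfl⟩, unit_rng q, rfl, ?_⟩ _
  congr 1
  apply Quad.ext
  · rfl
  · exact (zero_add _).symm
  · rfl
  · rfl

lemma inv_mul (g : Arrow A B) : mul (inv g) g (src_inv g) = unit B (src g) := by
  obtain ⟨q, rfl⟩ := exists_mk g
  refine mul_eq ⟨q.inv B, q, ⟨rfl, rfl⟩, rfl, rfl, ?_⟩ _
  refine (unit_src q).trans ?_
  congr 1
  apply Quad.ext
  · rfl
  · exact (neg_add_cancel _).symm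
  · rfl
  · rfl

lemma mul_inv (g : Arrow A B) : mul g (inv g) (rng_inv g).symm = unit B (rng g) := by
  obtain ⟨q, rfl⟩ := exists_mk g
  have c : Quad.Composable B q (q.inv B) :=
    ⟨rfl, by simp only [Quad.inv, ← InfPath.act_add, neg_add_cancel, InfPath.act_zero]⟩
  refine mul_eq ⟨q, q.inv B, c, rfl, rfl, ?_⟩ _
  refine (unit_rng q).trans ?_
  congr 1
  apply Quad.ext
  · rfl
  · exact (add_neg_cancel _).symm
  · rfl
  · rfl

/-- The set `Z(α, m, β; Z(β))`, for a quadruple `q = (α, m, β; x)`. -/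
def cyl (B : Matrix ι ι ℤ) (q : Quad A) : Set (Arrow A B) :=
  {g | ∃ r : Quad A, r.left = q.left ∧ r.deg = q.deg ∧ r.right = q.right ∧ g = mk B r}

lemma seqAppend_get (l : List (Edge A)) (y y' : ℕ → Edge A) (n : ℕ) (h : n < l.length) :
    seqAppend l y n = seqAppend l y' n := by
  induction l generalizing n with
  | nil => simp at h
  | cons a l ih =>
    cases n with
    | zero => rfl
    | succ n => exact ih n (by simpa using h)

lemma seqAppend_of_agree (v : ι) (l : List (Edge A)) (y x : ℕ → Edge A)
    (h : ∀ n ≤ l.length, x n = seqAppend l y n) (hy : endVertex v l = (y 0).src) :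
    x = seqAppend l (fun n => x (n + l.length)) ∧ endVertex v l = (x l.length).src := by
  induction l generalizing v x with
  | nil =>
    refine ⟨rfl, ?_⟩
    rw [hy]; exact congrArg Edge.src (h 0 le_rfl).symm
  | cons a l ih =>
    obtain ⟨h1, h2⟩ := ih a.tgt (fun n => x (n + 1))
      (fun n hn => h (n + 1) (by simpa using hn)) hy
    refine ⟨?_, h2⟩
    funext n
    cases n with
    | zero => exact h 0 (Nat.zero_le _)
    | succ n => exact congrFun h1 n

/-- Every neighbourhood of `x` contains all the paths that agree with `x` long enough. -/
lemma exists_agree {U : Set (InfPath A)} (hU : IsOpen U) {x : InfPath A} (hx : x ∈ U) :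
    ∃ N, ∀ x' : InfPath A, (∀ n < N, x'.edge n = x.edge n) → x' ∈ U := by
  obtain ⟨V, hV, rfl⟩ := isOpen_induced_iff.1 hU
  obtain ⟨I, u, hu, hI⟩ := isOpen_pi_iff.1 hV x.edge hx
  refine ⟨I.sup id + 1, fun x' h => hI fun i hi => ?_⟩
  rw [h i (Nat.lt_succ_of_le (Finset.le_sup (f := id) hi))]
  exact (hu i hi).2

lemma isOpen_agree (x : InfPath A) (N : ℕ) :
    IsOpen {x' : InfPath A | ∀ n < N, x'.edge n = x.edge n} := by
  have : {x' : InfPath A | ∀ n < N, x'.edge n = x.edge n} =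
      ⋂ n ∈ Finset.range N, (fun x' : InfPath A => x'.edge n) ⁻¹' {x.edge n} := by
    ext; simp
  rw [this]
  refine isOpen_biInter_finset fun n _ => ?_
  exact (isOpen_discrete _).preimage ((continuous_apply n).comp continuous_induced_dom)

lemma isOpen_cylinder (β : FinPath A) : IsOpen β.cylinder := by
  rw [isOpen_iff_forall_mem_open]
  rintro x ⟨y, h, rfl⟩
  refine ⟨_, fun x' hx' => ?_, isOpen_agree (β.concat y h) (β.length + 1), fun n _ => rfl⟩
  obtain ⟨h1, h2⟩ := seqAppend_of_agree β.source β.edges y.edge x'.edge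
    (fun n hn => hx' n (Nat.lt_succ_of_le hn)) h
  exact ⟨⟨fun n => x'.edge (n + β.edges.length), fun n => by
    rw [x'.isPath, Nat.add_right_comm]⟩, by rw [FinPath.range, h2]; simp [InfPath.source],
    InfPath.ext h1⟩

lemma isOpen_cyl (q : Quad A) : IsOpen (cyl B q) := by
  refine TopologicalSpace.isOpen_generateFrom_of_mem ⟨q.left, q.deg, q.right, q.right.cylinder,
    q.left_range.trans q.right_range.symm, isOpen_cylinder _, subset_rfl, ?_⟩
  ext g
  constructor
  · rintro ⟨r, h1, h2, h3, rfl⟩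
    refine ⟨r, h1, h2, h3, ?_, rfl⟩
    rw [← h3]; exact ⟨_, r.right_range, rfl⟩
  · rintro ⟨r, h1, h2, h3, -, rfl⟩
    exact ⟨r, h1, h2, h3, rfl⟩

lemma mem_cyl (q : Quad A) : mk B q ∈ cyl B q := ⟨q, rfl, rfl, rfl, rfl⟩

lemma exists_refine (q r : Quad A) (h1 : r.left = (q.refine B).left)
    (h2 : r.deg = (q.refine B).deg) (h3 : r.right = (q.refine B).right) :
    ∃ r0 : Quad A, r0.left = q.left ∧ r0.deg = q.deg ∧ r0.right = q.right ∧ r0.refine B = r := by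
  have hr : (q.tail.edge 0).tgt = r.tail.source := by
    rw [← r.right_range, h3]; exact (FinPath.range_snoc _ _ q.right_range).symm
  refine ⟨⟨q.left, q.deg, q.right, ⟨fun n => seqAppend [q.tail.edge 0] r.tail.edge n, ?_⟩,
    q.left_range, q.right_range⟩, rfl, rfl, rfl, ?_⟩
  · intro n
    cases n with
    | zero => exact hr
    | succ n => exact r.tail.isPath n
  · exact Quad.ext h1.symm h2.symm h3.symm rfl

lemma exists_iterate (q r : Quad A) (n : ℕ) (h1 : r.left = ((Quad.refine B)^[n] q).left)
    (h2 : r.deg = ((Quad.refine B)^[n] q).deg) (h3 : r.right = ((Quad.refine B)^[n] q).right) :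
    ∃ r0 : Quad A, r0.left = q.left ∧ r0.deg = q.deg ∧ r0.right = q.right ∧
      (Quad.refine B)^[n] r0 = r := by
  induction n generalizing r with
  | zero => exact ⟨r, h1, h2, h3, rfl⟩
  | succ n ih =>
    rw [Function.iterate_succ_apply'] at h1 h2 h3
    obtain ⟨r1, a1, a2, a3, rfl⟩ := exists_refine _ r h1 h2 h3
    obtain ⟨r0, b1, b2, b3, rfl⟩ := ih r1 a1 a2 a3
    exact ⟨r0, b1, b2, b3, Function.iterate_succ_apply' _ _ _⟩

lemma src_agree {q r : Quad A} (h : r.right = q.right) (n : ℕ) (hn : n < q.right.length) :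
    r.src.edge n = q.src.edge n := by
  simp only [Quad.src, FinPath.concat, h]
  exact seqAppend_get _ _ _ _ hn

lemma rng_agree {q r : Quad A} (h : r.left = q.left) (n : ℕ) (hn : n < q.left.length) :
    (r.rng B).edge n = (q.rng B).edge n := by
  simp only [Quad.rng, FinPath.concat, h]
  exact seqAppend_get _ _ _ _ hn

/-- The sets `Z(α, m, β; Z(β))` form a basis of the topology. -/
lemma exists_cyl_subset {S : Set (Arrow A B)} (hS : IsOpen S) (q : Quad A) (hq : mk B q ∈ S) :
    ∃ N, ∀ n ≥ N, cyl B ((Quad.refine B)^[n] q) ⊆ S := by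
  induction hS with
  | basic S hS =>
    obtain ⟨α, m, β, U, hr, hU, hUβ, rfl⟩ := hS
    obtain ⟨q0, rfl, rfl, rfl, hq0, e⟩ := hq
    obtain ⟨a, b, e⟩ := (mk_eq_iff _ _).1 e
    obtain ⟨N, hN⟩ := exists_agree hU hq0
    refine ⟨a + N, fun n hn => ?_⟩
    obtain ⟨c, rfl⟩ : ∃ c, n = c + a := ⟨n - a, by omega⟩
    rw [Function.iterate_add_apply, e, ← Function.iterate_add_apply]
    rintro g ⟨r, h1, h2, h3, rfl⟩
    obtain ⟨r0, b1, b2, b3, rfl⟩ := exists_iterate _ r _ h1 h2 h3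
    refine ⟨r0, b1, b2, b3, hN _ fun i hi => ?_, mk_iterate _ _⟩
    have := src_agree h3 i (by rw [Quad.length_right_iterate]; omega)
    rwa [Quad.src_iterate, Quad.src_iterate] at this
  | univ => exact ⟨0, fun _ _ => Set.subset_univ _⟩
  | inter s t _ _ ih1 ih2 =>
    obtain ⟨N1, h1⟩ := ih1 hq.1
    obtain ⟨N2, h2⟩ := ih2 hq.2
    exact ⟨max N1 N2, fun n hn => Set.subset_inter (h1 n (le_of_max_le_left hn))
      (h2 n (le_of_max_le_right hn))⟩
  | sUnion S _ ih =>
    obtain ⟨s, hs, hqs⟩ := hq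
    obtain ⟨N, h⟩ := ih s hs hqs
    exact ⟨N, fun n hn => (h n hn).trans (Set.subset_sUnion_of_mem hs)⟩

lemma mem_cyl_iterate (q : Quad A) (n : ℕ) : mk B q ∈ cyl B ((Quad.refine B)^[n] q) := by
  rw [← mk_iterate q n]; exact mem_cyl _

lemma continuous_src : Continuous (src : Arrow A B → InfPath A) := by
  refine ⟨fun W hW => isOpen_iff_forall_mem_open.2 fun g hg => ?_⟩
  obtain ⟨q, rfl⟩ := exists_mk g
  obtain ⟨N, hN⟩ := exists_agree hW hg
  refine ⟨_, ?_, isOpen_cyl ((Quad.refine B)^[N] q), mem_cyl_iterate q N⟩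
  rintro _ ⟨r, -, -, h3, rfl⟩
  refine hN _ fun n hn => ?_
  have := src_agree h3 n (by rw [Quad.length_right_iterate]; omega)
  rwa [Quad.src_iterate] at this

lemma continuous_rng : Continuous (rng : Arrow A B → InfPath A) := by
  refine ⟨fun W hW => isOpen_iff_forall_mem_open.2 fun g hg => ?_⟩
  obtain ⟨q, rfl⟩ := exists_mk g
  obtain ⟨N, hN⟩ := exists_agree hW hg
  refine ⟨_, ?_, isOpen_cyl ((Quad.refine B)^[N] q), mem_cyl_iterate q N⟩
  rintro _ ⟨r, h1, -, -, rfl⟩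
  refine hN _ fun n hn => ?_
  have := rng_agree (B := B) h1 n (by rw [Quad.length_left_iterate]; omega)
  rwa [Quad.rng_iterate] at this

lemma continuous_inv : Continuous (inv : Arrow A B → Arrow A B) := by
  refine ⟨fun S hS => isOpen_iff_forall_mem_open.2 fun g hg => ?_⟩
  obtain ⟨q, rfl⟩ := exists_mk g
  obtain ⟨N, hN⟩ := exists_cyl_subset hS (q.inv B) hg
  refine ⟨_, ?_, isOpen_cyl ((Quad.refine B)^[N] q), mem_cyl_iterate q N⟩
  rintro _ ⟨r, h1, h2, h3, rfl⟩
  refine hN N le_rfl ⟨r.inv B, ?_⟩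
  rw [← Quad.inv_iterate]
  exact ⟨h3, congrArg Neg.neg h2, h1, rfl⟩

lemma continuous_unit : Continuous (unit B : InfPath A → Arrow A B) := by
  refine ⟨fun S hS => isOpen_iff_forall_mem_open.2 fun x hx => ?_⟩
  obtain ⟨N, hN⟩ := exists_cyl_subset hS _ hx
  have h := hN N le_rfl
  have hs := Quad.src_iterate (B := B) (Quad.idem (FinPath.vertex A x.source) x rfl) N
  obtain ⟨β, y, h', e⟩ := Quad.iterate_idem (B := B) (FinPath.vertex A x.source) x rfl N
  rw [e] at h hs
  refine ⟨β.cylinder, ?_, isOpen_cylinder β, ⟨y, h', hs.symm⟩⟩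
  rintro _ ⟨y1, h1, rfl⟩
  exact h ⟨Quad.idem β y1 h1, rfl, rfl, rfl, unit_src (Quad.idem β y1 h1)⟩

lemma continuous_mul : Continuous
    (fun p : {p : Arrow A B × Arrow A B // src p.1 = rng p.2} => mul p.1.1 p.1.2 p.2) := by
  refine ⟨fun S hS => isOpen_iff_forall_mem_open.2 ?_⟩
  rintro ⟨⟨g, h⟩, e⟩ hS'
  obtain ⟨q, p, c, rfl, rfl, hk⟩ := mul_spec g h e
  have hS'' : mk B (q.comp p c) ∈ S := by rw [← hk]; exact hS'
  obtain ⟨N, hN⟩ := exists_cyl_subset hS _ hS''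
  have hN := hN N le_rfl
  obtain ⟨c', ec⟩ := Quad.comp_iterate c N
  rw [← ec] at hN
  refine ⟨Subtype.val ⁻¹' (cyl B ((Quad.refine B)^[N] q) ×ˢ cyl B ((Quad.refine B)^[N] p)), ?_,
    ((isOpen_cyl _).prod (isOpen_cyl _)).preimage continuous_subtype_val,
    ⟨mem_cyl_iterate q N, mem_cyl_iterate p N⟩⟩
  rintro ⟨⟨g1, h1⟩, e1⟩ ⟨⟨r, a1, a2, a3, hr⟩, ⟨t, b1, b2, b3, ht⟩⟩
  dsimp only at hr ht
  subst hr ht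
  have d : Quad.Composable B r t := by
    apply Quad.composable_of
    · exact e1
    · rw [a3, b1, c'.1]
  refine hN ⟨r.comp t d, a1, ?_, b3, mul_mk d e1⟩
  change r.deg + t.deg = _
  rw [a2, b2]; rfl

end Arrow

/-- The Katsura-Exel-Pardo groupoid `G_{A,B}`, with unit space the infinite path space. -/
noncomputable def kepGroupoid (A B : Matrix ι ι ℤ) : TopGroupoid.{u, u} (InfPath A) where
  Arrow := Arrow A B
  src := Arrow.src
  rng := Arrow.rng
  unit := Arrow.unit B
  inv := Arrow.inv
  mul := Arrow.mul
  src_unit := Arrow.src_unit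
  rng_unit := Arrow.rng_unit
  src_inv := Arrow.src_inv
  rng_inv := Arrow.rng_inv
  src_mul := Arrow.src_mul
  rng_mul := Arrow.rng_mul
  mul_assoc := Arrow.mul_assoc
  mul_unit := Arrow.mul_unit
  unit_mul := Arrow.unit_mul
  inv_mul := Arrow.inv_mul
  mul_inv := Arrow.mul_inv
  continuous_src := Arrow.continuous_src
  continuous_rng := Arrow.continuous_rng
  continuous_unit := Arrow.continuous_unit
  continuous_inv := Arrow.continuous_inv
  continuous_mul := Arrow.continuous_mul

/-- The restriction of `G_{A,B}` to `Z(v)`. -/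
noncomputable def restrictedKepGroupoid (A B : Matrix ι ι ℤ) (v : ι) :
    TopGroupoid.{u, u} (FinPath.vertex A v).cylinder :=
  (kepGroupoid A B).restrict (FinPath.vertex A v).cylinder

end KatsuraGroupoid

/-! ## Bratteli diagrams -/

/-- A Bratteli diagram with vertex set `V` and edge set `E`: `V` is the disjoint union of finite
non-empty sets `V_n = {v | level v = n}` with `V_0 = {root}`, and `E` is the union of the finite
non-empty sets `E_{n+1}` of edges from `V_n` to `V_{n+1}`. -/
structure BratteliDiagram (V : Type u) (E : Type v) where
  level : V → ℕ
  root : V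
  src : E → V
  tgt : E → V
  level_eq_zero_iff : ∀ v, level v = 0 ↔ v = root
  finite_vertices : ∀ n, {v | level v = n}.Finite
  nonempty_vertices : ∀ n, {v | level v = n}.Nonempty
  level_tgt : ∀ e, level (tgt e) = level (src e) + 1
  finite_edges : ∀ n, {e | level (src e) = n}.Finite
  nonempty_edges : ∀ n, {e | level (src e) = n}.Nonempty

/-- The incidence matrix of a Bratteli diagram, relative to an enumeration of its vertices by `ι`:
the `(i, j)` entry is the number of edges from the `i`-th to the `j`-th vertex. -/
noncomputable def BratteliDiagram.incidenceMatrix {V : Type u} {E : Type v} {ι : Type*}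
    (D : BratteliDiagram V E) (enum : ι ≃ V) : Matrix ι ι ℤ :=
  fun i j => (Nat.card {e : E // D.src e = enum i ∧ D.tgt e = enum j} : ℤ)

/-!
The maps `s` and `r` carry `Z(α, m, β; Z(β))` bijectively onto `Z(β)` and `Z(α)`, and neither of
these sets involves `B`. Two cylinders `Z(β)` are nested or disjoint, so every bisection of
`G_{A,B}` is a union of sets `Z(α, m, β; Z(β))` for which the `Z(β)` are pairwise disjoint and the
`Z(α)` are pairwise disjoint. The union of the sets with the same labels in `G_{A,B'}` is then a
bisection with the same source and range. Hence the pairs `(s(U), r(U))`, on which alone the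
invariance of a measure depends, are the same for all `B`.
-/

lemma injOn_biUnion_of_pairwiseDisjoint_image {α β κ : Type*} {I : Set κ} {S : κ → Set α}
    {f : α → β} (hf : ∀ i ∈ I, Set.InjOn f (S i)) (hI : I.PairwiseDisjoint fun i => f '' S i) :
    Set.InjOn f (⋃ i ∈ I, S i) := by
  intro a ha b hb hab
  obtain ⟨i, hi, hai⟩ := Set.mem_iUnion₂.1 ha
  obtain ⟨j, hj, hbj⟩ := Set.mem_iUnion₂.1 hb
  obtain rfl : i = j := hI.elim_set hi hj (f a) ⟨a, hai, rfl⟩ ⟨b, hbj, hab.symm⟩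
  exact hf i hi hai hbj hab

lemma pairwiseDisjoint_image_of_injOn_biUnion {α β κ : Type*} {I : Set κ} {S : κ → Set α}
    {f : α → β} (hf : Set.InjOn f (⋃ i ∈ I, S i)) (hI : I.PairwiseDisjoint S) :
    I.PairwiseDisjoint fun i => f '' S i := by
  intro i hi j hj hij
  change Disjoint (f '' S i) (f '' S j)
  rw [Set.disjoint_iff_inter_eq_empty, ← hf.image_inter (Set.subset_biUnion_of_mem hi)
    (Set.subset_biUnion_of_mem hj), (hI hi hj hij).inter_eq, Set.image_empty]

namespace TopGroupoid

variable {X : Type u} [TopologicalSpace X]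

/-- The pairs `(s(U), r(U))` for `U` a bisection: the part of the structure of a groupoid on which
its set of invariant probability measures depends. -/
def bisectionPairs (G : TopGroupoid.{u, v} X) : Set (Set X × Set X) :=
  (fun U => (G.src '' U, G.rng '' U)) '' {U | G.IsBisection U}

lemma mem_invariantProbabilityMeasures_iff [MeasurableSpace X] [BorelSpace X]
    {G : TopGroupoid.{u, v} X} {μ : MeasureTheory.ProbabilityMeasure X} :
    μ ∈ G.invariantProbabilityMeasures ↔
      ∀ p ∈ G.bisectionPairs,
        (μ : MeasureTheory.Measure X) p.1 = (μ : MeasureTheory.Measure X) p.2 := by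
  rw [bisectionPairs, Set.forall_mem_image]
  rfl

variable {G : TopGroupoid.{u, v} X} {Y : Set X}

lemma IsBisection.image_val (hY : IsOpen Y) {U : Set (G.restrict Y).Arrow}
    (hU : (G.restrict Y).IsBisection U) : G.IsBisection (Subtype.val '' U) := by
  have hGY : IsOpen {g : G.Arrow | G.src g ∈ Y ∧ G.rng g ∈ Y} :=
    (hY.preimage G.continuous_src).inter (hY.preimage G.continuous_rng)
  obtain ⟨hopen, hsrc, hrng⟩ := hU
  refine ⟨hGY.isOpenMap_subtype_val U hopen, ?_, ?_⟩
  · rintro _ ⟨g, hg, rfl⟩ _ ⟨h, hh, rfl⟩ e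
    exact congrArg Subtype.val (hsrc hg hh (Subtype.ext e))
  · rintro _ ⟨g, hg, rfl⟩ _ ⟨h, hh, rfl⟩ e
    exact congrArg Subtype.val (hrng hg hh (Subtype.ext e))

lemma IsBisection.preimage_val {U : Set G.Arrow} (hU : G.IsBisection U) (Y : Set X) :
    (G.restrict Y).IsBisection (Subtype.val ⁻¹' U) := by
  obtain ⟨hopen, hsrc, hrng⟩ := hU
  exact ⟨hopen.preimage continuous_subtype_val,
    fun _ hg _ hh e => Subtype.ext (hsrc hg hh (congrArg Subtype.val e)),
    fun _ hg _ hh e => Subtype.ext (hrng hg hh (congrArg Subtype.val e))⟩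

lemma val_image_src_restrict (U : Set (G.restrict Y).Arrow) :
    Subtype.val '' ((G.restrict Y).src '' U) = G.src '' (Subtype.val '' U) :=
  Set.image_comm fun _ => rfl

lemma val_image_rng_restrict (U : Set (G.restrict Y).Arrow) :
    Subtype.val '' ((G.restrict Y).rng '' U) = G.rng '' (Subtype.val '' U) :=
  Set.image_comm fun _ => rfl

lemma bisectionPairs_restrict (G : TopGroupoid.{u, v} X) (hY : IsOpen Y) :
    (G.restrict Y).bisectionPairs =
      Prod.map (Set.image Subtype.val) (Set.image Subtype.val) ⁻¹' G.bisectionPairs := by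
  apply Set.Subset.antisymm
  · rintro _ ⟨U, hU, rfl⟩
    exact ⟨_, hU.image_val hY,
      Prod.ext (val_image_src_restrict U).symm (val_image_rng_restrict U).symm⟩
  · rintro ⟨V, W⟩ ⟨U, hU, hVW⟩
    obtain ⟨hV, hW⟩ : G.src '' U = Subtype.val '' V ∧ G.rng '' U = Subtype.val '' W :=
      Prod.ext_iff.1 hVW
    have hUY : U ⊆ Set.range (Subtype.val : (G.restrict Y).Arrow → G.Arrow) := fun g hg =>
      ⟨⟨g, Subtype.coe_image_subset Y V (hV ▸ Set.mem_image_of_mem G.src hg),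
        Subtype.coe_image_subset Y W (hW ▸ Set.mem_image_of_mem G.rng hg)⟩, rfl⟩
    have hval : Subtype.val '' (Subtype.val ⁻¹' U : Set (G.restrict Y).Arrow) = U :=
      Set.image_preimage_eq_of_subset hUY
    have hsrc : Subtype.val '' ((G.restrict Y).src '' (Subtype.val ⁻¹' U)) = Subtype.val '' V :=
      (val_image_src_restrict _).trans (hval.symm ▸ hV)
    have hrng : Subtype.val '' ((G.restrict Y).rng '' (Subtype.val ⁻¹' U)) = Subtype.val '' W :=
      (val_image_rng_restrict _).trans (hval.symm ▸ hW)
    exact ⟨_, hU.preimage_val Y, Prod.ext (Subtype.val_injective.image_injective hsrc)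
      (Subtype.val_injective.image_injective hrng)⟩

end TopGroupoid

namespace KatsuraGroupoid

variable {ι : Type u} {A B : Matrix ι ι ℤ}

lemma seqAppend_eq_getElem (l : List (Edge A)) (y : ℕ → Edge A) (n : ℕ) (hn : n < l.length) :
    seqAppend l y n = l[n] := by
  induction l generalizing n with
  | nil => simp at hn
  | cons a l ih =>
    cases n with
    | zero => rfl
    | succ n => exact ih n (Nat.lt_of_succ_lt_succ hn)

lemma seqAppend_drop (l : List (Edge A)) (x : ℕ → Edge A)
    (hx : ∀ n (hn : n < l.length), x n = l[n]) :
    seqAppend l (fun n => x (n + l.length)) = x := by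
  induction l generalizing x with
  | nil => rfl
  | cons a l ih =>
    funext n
    cases n with
    | zero => exact (hx 0 (Nat.succ_pos _)).symm
    | succ n =>
      exact congrFun (ih (fun n => x (n + 1)) fun n hn => hx (n + 1) (Nat.succ_lt_succ hn)) n

lemma endVertex_eq_src (l : List (Edge A)) (x : InfPath A)
    (hx : ∀ n (hn : n < l.length), x.edge n = l[n]) :
    endVertex x.source l = (x.edge l.length).src := by
  induction l generalizing x with
  | nil => rfl
  | cons a l ih =>
    have htail : endVertex x.tail.source l = (x.edge (l.length + 1)).src :=
      ih x.tail fun n hn => hx (n + 1) (Nat.succ_lt_succ hn)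
    have ha : x.tail.source = a.tgt :=
      (x.isPath 0).symm.trans (congrArg Edge.tgt (hx 0 (Nat.succ_pos _)))
    rwa [ha] at htail

namespace FinPath

lemma mem_cylinder_iff {β : FinPath A} {x : InfPath A} :
    x ∈ β.cylinder ↔
      x.source = β.source ∧ ∀ n (hn : n < β.edges.length), x.edge n = β.edges[n] := by
  constructor
  · rintro ⟨y, hy, rfl⟩
    exact ⟨source_concat β y hy, seqAppend_eq_getElem β.edges y.edge⟩
  · rintro ⟨hsource, hedges⟩
    have hrange : β.range = (x.edge (0 + β.edges.length)).src := by
      rw [Nat.zero_add, ← endVertex_eq_src β.edges x hedges, hsource]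
      rfl
    refine ⟨⟨fun n => x.edge (n + β.edges.length), fun n => ?_⟩, hrange,
      InfPath.ext (seqAppend_drop β.edges x.edge hedges).symm⟩
    rw [x.isPath, Nat.add_right_comm]

lemma cylinder_subset_cylinder {β γ : FinPath A} (hlength : γ.length ≤ β.length)
    (hmeet : (β.cylinder ∩ γ.cylinder).Nonempty) : β.cylinder ⊆ γ.cylinder := by
  obtain ⟨x, hxβ, hxγ⟩ := hmeet
  intro z hz
  rw [mem_cylinder_iff] at hxβ hxγ hz ⊢
  refine ⟨hz.1.trans (hxβ.1.symm.trans hxγ.1), fun n hn => ?_⟩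
  have hnβ : n < β.edges.length := hn.trans_le hlength
  rw [hz.2 n hnβ, ← hxβ.2 n hnβ, hxγ.2 n hn]

lemma eq_of_length_eq_of_cylinder_inter_nonempty {β γ : FinPath A}
    (hlength : β.length = γ.length) (hmeet : (β.cylinder ∩ γ.cylinder).Nonempty) : β = γ := by
  obtain ⟨_, ⟨y, hy, rfl⟩, y', hy', e⟩ := hmeet
  exact (concat_inj β γ y y' hy hy' hlength e).1

lemma exists_subset_pairwiseDisjoint_cylinder (C : Set (FinPath A)) :
    ∃ T ⊆ C, T.PairwiseDisjoint cylinder ∧ ⋃ β ∈ T, β.cylinder = ⋃ β ∈ C, β.cylinder := by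
  let T : Set (FinPath A) :=
    {β ∈ C | ∀ γ ∈ C, (β.cylinder ∩ γ.cylinder).Nonempty → β.length ≤ γ.length}
  have hTC : T ⊆ C := Set.sep_subset _ _
  refine ⟨T, hTC, fun β hβ γ hγ hne => ?_, (Set.biUnion_subset_biUnion_left hTC).antisymm ?_⟩
  · by_contra hdisj
    have hmeet : (β.cylinder ∩ γ.cylinder).Nonempty := Set.not_disjoint_iff_nonempty_inter.1 hdisj
    have hlength : β.length = γ.length :=
      (hβ.2 γ hγ.1 hmeet).antisymm (hγ.2 β hβ.1 (Set.inter_comm _ _ ▸ hmeet))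
    exact hne (eq_of_length_eq_of_cylinder_inter_nonempty hlength hmeet)
  · intro x hx
    obtain ⟨β₀, hβ₀C, hxβ₀⟩ := Set.mem_iUnion₂.1 hx
    obtain ⟨β, ⟨hβC, hxβ⟩, hmin⟩ :=
      exists_minimalFor_of_wellFoundedLT (fun β => β ∈ C ∧ x ∈ β.cylinder) length
        ⟨β₀, hβ₀C, hxβ₀⟩
    refine Set.mem_iUnion₂.2 ⟨β, ⟨hβC, fun γ hγC hmeet => ?_⟩, hxβ⟩
    by_contra! hlt
    exact hlt.not_ge (hmin ⟨hγC, cylinder_subset_cylinder hlt.le hmeet hxβ⟩ hlt.le)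

end FinPath

lemma Quad.inv_inv (q : Quad A) : (q.inv B).inv B = q := by
  apply Quad.ext
  · rfl
  · exact neg_neg q.deg
  · rfl
  · change (q.tail.act B q.deg).act B (-q.deg) = q.tail
    rw [← InfPath.act_add, neg_add_cancel, InfPath.act_zero]

namespace Arrow

lemma inv_inv (g : Arrow A B) : inv (inv g) = g := by
  obtain ⟨q, rfl⟩ := exists_mk g
  exact congrArg (mk B) q.inv_inv

lemma inv_mem_cyl {q : Quad A} {g : Arrow A B} (hg : g ∈ cyl B q) : inv g ∈ cyl B (q.inv B) := by
  obtain ⟨r, hleft, hdeg, hright, rfl⟩ := hg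
  exact ⟨r.inv B, hright, congrArg Neg.neg hdeg, hleft, rfl⟩

lemma inv_image_cyl (q : Quad A) : inv '' cyl B q = cyl B (q.inv B) := by
  refine Set.Subset.antisymm (Set.image_subset_iff.2 fun _ => inv_mem_cyl) fun g hg => ?_
  exact ⟨inv g, q.inv_inv (B := B) ▸ inv_mem_cyl hg, inv_inv g⟩

lemma src_image_cyl (q : Quad A) : src '' cyl B q = q.right.cylinder := by
  apply Set.Subset.antisymm
  · rintro _ ⟨_, ⟨r, -, -, hright, rfl⟩, rfl⟩
    exact hright ▸ ⟨r.tail, r.right_range, rfl⟩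
  · rintro _ ⟨y, hy, rfl⟩
    have hleft : q.left.range = y.source := q.left_range.trans (q.right_range.symm.trans hy)
    let r : Quad A := ⟨q.left, q.deg, q.right, y, hleft, hy⟩
    exact ⟨mk B r, ⟨r, rfl, rfl, rfl, rfl⟩, rfl⟩

lemma injOn_src_cyl (q : Quad A) : Set.InjOn src (cyl B q) := by
  rintro _ ⟨r, hrl, hrd, hrr, rfl⟩ _ ⟨t, htl, htd, htr, rfl⟩ e
  have htail : r.tail = t.tail :=
    (FinPath.concat_inj _ _ _ _ r.right_range t.right_range (by rw [hrr, htr]) e).2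
  exact congrArg (mk B)
    (Quad.ext (hrl.trans htl.symm) (hrd.trans htd.symm) (hrr.trans htr.symm) htail)

lemma rng_image_cyl (q : Quad A) : rng '' cyl B q = q.left.cylinder := by
  calc rng '' cyl B q = src '' (inv '' cyl B q) := by simp only [Set.image_image, src_inv]
    _ = q.left.cylinder := by rw [inv_image_cyl, src_image_cyl]; rfl

lemma injOn_rng_cyl (q : Quad A) : Set.InjOn rng (cyl B q) := by
  intro g hg h hh e
  have hinv : inv g = inv h :=
    injOn_src_cyl (q.inv B) (inv_mem_cyl hg) (inv_mem_cyl hh) (by rw [src_inv, src_inv, e])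
  rw [← inv_inv g, hinv, inv_inv]

lemma src_image_biUnion_cyl (Q : Set (Quad A)) :
    src '' ⋃ q ∈ Q, cyl B q = ⋃ q ∈ Q, q.right.cylinder := by
  simp only [Set.image_iUnion₂, src_image_cyl]

lemma rng_image_biUnion_cyl (Q : Set (Quad A)) :
    rng '' ⋃ q ∈ Q, cyl B q = ⋃ q ∈ Q, q.left.cylinder := by
  simp only [Set.image_iUnion₂, rng_image_cyl]

lemma biUnion_cyl_eq_of_isOpen {S : Set (Arrow A B)} (hS : IsOpen S) :
    ⋃ q ∈ {q : Quad A | cyl B q ⊆ S}, cyl B q = S := by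
  refine Set.Subset.antisymm (Set.iUnion₂_subset fun _ hq => hq) fun g hg => ?_
  obtain ⟨q, rfl⟩ := exists_mk g
  obtain ⟨N, hN⟩ := exists_cyl_subset hS q hg
  exact Set.mem_iUnion₂.2 ⟨_, hN N le_rfl, mem_cyl_iterate q N⟩

lemma exists_pairwiseDisjoint_biUnion_cyl_eq {S : Set (Arrow A B)} (hS : IsOpen S)
    (hsrc : Set.InjOn src S) :
    ∃ Q : Set (Quad A), Q.PairwiseDisjoint (fun q => q.right.cylinder) ∧
      ⋃ q ∈ Q, cyl B q = S := by
  obtain ⟨T, hT, hTdisj, hTunion⟩ :=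
    FinPath.exists_subset_pairwiseDisjoint_cylinder (Quad.right '' {q | cyl B q ⊆ S})
  obtain ⟨Q, hQS, hQT⟩ := Set.SurjOn.exists_bijOn_subset hT
  have hQdisj : Q.PairwiseDisjoint (FinPath.cylinder ∘ Quad.right) :=
    hQT.injOn.pairwiseDisjoint_image.1 (hQT.image_eq.symm ▸ hTdisj)
  have himage : src '' ⋃ q ∈ Q, cyl B q = src '' S :=
    calc src '' ⋃ q ∈ Q, cyl B q = ⋃ β ∈ T, β.cylinder := by
          rw [src_image_biUnion_cyl, ← hQT.image_eq, Set.biUnion_image]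
      _ = src '' ⋃ q ∈ {q : Quad A | cyl B q ⊆ S}, cyl B q := by
          rw [hTunion, src_image_biUnion_cyl, Set.biUnion_image]
      _ = src '' S := by rw [biUnion_cyl_eq_of_isOpen hS]
  exact ⟨Q, hQdisj, (hsrc.image_eq_image_iff (Set.iUnion₂_subset hQS) subset_rfl).1 himage⟩

end Arrow

lemma isBisection_kepGroupoid_iff {S : Set (Arrow A B)} :
    (kepGroupoid A B).IsBisection S ↔
      ∃ Q : Set (Quad A), Q.PairwiseDisjoint (fun q => q.right.cylinder) ∧
        Q.PairwiseDisjoint (fun q => q.left.cylinder) ∧ ⋃ q ∈ Q, Arrow.cyl B q = S := by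
  constructor
  · rintro ⟨hopen, hsrc, hrng⟩
    obtain ⟨Q, hright, rfl⟩ := Arrow.exists_pairwiseDisjoint_biUnion_cyl_eq hopen hsrc
    have hcyl : Q.PairwiseDisjoint (Arrow.cyl B) := fun q hq p hp hne =>
      Disjoint.of_image (f := Arrow.src)
        (by simpa only [Arrow.src_image_cyl] using hright hq hp hne)
    have hleft : Q.PairwiseDisjoint fun q => Arrow.rng '' Arrow.cyl B q :=
      pairwiseDisjoint_image_of_injOn_biUnion hrng hcyl
    exact ⟨Q, hright, by simpa only [Arrow.rng_image_cyl] using hleft, rfl⟩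
  · rintro ⟨Q, hright, hleft, rfl⟩
    simp only [← Arrow.src_image_cyl (B := B)] at hright
    simp only [← Arrow.rng_image_cyl (B := B)] at hleft
    exact ⟨isOpen_biUnion fun q _ => Arrow.isOpen_cyl q,
      injOn_biUnion_of_pairwiseDisjoint_image (fun q _ => Arrow.injOn_src_cyl q) hright,
      injOn_biUnion_of_pairwiseDisjoint_image (fun q _ => Arrow.injOn_rng_cyl q) hleft⟩

lemma bisectionPairs_kepGroupoid (A B : Matrix ι ι ℤ) :
    (kepGroupoid A B).bisectionPairs =
      (fun Q : Set (Quad A) => (⋃ q ∈ Q, q.right.cylinder, ⋃ q ∈ Q, q.left.cylinder)) ''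
        {Q | Q.PairwiseDisjoint (fun q => q.right.cylinder) ∧
          Q.PairwiseDisjoint (fun q => q.left.cylinder)} := by
  have hpair (Q : Set (Quad A)) :
      (Arrow.src '' ⋃ q ∈ Q, Arrow.cyl B q, Arrow.rng '' ⋃ q ∈ Q, Arrow.cyl B q) =
        (⋃ q ∈ Q, q.right.cylinder, ⋃ q ∈ Q, q.left.cylinder) :=
    Prod.ext (Arrow.src_image_biUnion_cyl Q) (Arrow.rng_image_biUnion_cyl Q)
  apply Set.Subset.antisymm
  · rintro _ ⟨S, hS, rfl⟩
    obtain ⟨Q, hright, hleft, rfl⟩ := isBisection_kepGroupoid_iff.1 hS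
    exact ⟨Q, ⟨hright, hleft⟩, (hpair Q).symm⟩
  · rintro _ ⟨Q, ⟨hright, hleft⟩, rfl⟩
    exact ⟨_, isBisection_kepGroupoid_iff.2 ⟨Q, hright, hleft, rfl⟩, hpair Q⟩

end KatsuraGroupoid

theorem mainTheorem11_general {ι : Type*} (A B B' : Matrix ι ι ℤ)
    {Y : Set (KatsuraGroupoid.InfPath A)} (hY : IsOpen Y) :
    ((KatsuraGroupoid.kepGroupoid A B).restrict Y).invariantProbabilityMeasures =
      ((KatsuraGroupoid.kepGroupoid A B').restrict Y).invariantProbabilityMeasures := by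
  ext μ
  simp only [TopGroupoid.mem_invariantProbabilityMeasures_iff,
    TopGroupoid.bisectionPairs_restrict _ hY, KatsuraGroupoid.bisectionPairs_kepGroupoid]

theorem mainTheorem11 {ι V E W F : Type*}
    (D : BratteliDiagram V E) (D' : BratteliDiagram W F)
    (enumV : ι ≃ V) (enumW : ι ≃ W)
    (A B : Matrix ι ι ℤ)
    (hA : A = D.incidenceMatrix enumV) (hB : B = D'.incidenceMatrix enumW)
    (hBA : ∀ i j : ι, A i j ≠ 0 → |B i j| < A i j) :
    (KatsuraGroupoid.restrictedKepGroupoid A B (enumV.symm D.root)).invariantProbabilityMeasures =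
      (KatsuraGroupoid.restrictedKepGroupoid A 0
        (enumV.symm D.root)).invariantProbabilityMeasures :=
  mainTheorem11_general A B 0 (KatsuraGroupoid.Arrow.isOpen_cylinder _)
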